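/- **Platoon and its error dynamics.** Consider $N$ follower vehicles with error states $e_i(t)\in\mathbb{R}^3$ (location, velocity and acceleration error), disturbances $w_i(t)\in\mathbb{R}^3$ and performance outputs $z_i=e_i$, with closed-loop error dynamics $$\dot e_i=(A+B\bar L_{ii})e_i+\eta_i,\qquad \eta_i=\sum_{j=1}^N K_{ij}e_j+w_i,\qquad A=\begin{bmatrix}0&1&0\\0&0&1\\0&0&0\end{bmatrix},\quad B=\begin{bmatrix}0\\0\\1\end{bmatrix}.$$ Write $\mathrm{blk}(\kappa,\ell)$ for the $3\times3$ matrix with rows $(0,0,0)$, $(0,0,\kappa)$, $\ell\in\mathbb{R}^{1\times3}$. The coupling blocks come from the controller gains in one of two ways (fixed throughout). (I) Gains $\bar k_{ij}$ ($j\ne i$), $\bar k_{i0}\in\mathbb{R}$, $L_{ii}\in\mathbb{R}^{1\times3}$: $K_{ij}=\mathrm{blk}(-\bar k_{ij},0)$ for $j\neq i$, and $K_{ii}=\mathrm{blk}(\bar k_{i0}+\sum_{j\ne i}\bar k_{ij}-1,\,L_{ii})$; put $K_{i0}=\mathrm{blk}(\bar k_{i0}-1,L_{ii})$. (II) Gains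 $L_{ij}\in\mathbb{R}^{1\times 3}$: $K_{ij}=\mathrm{blk}(0,-L_{ij})$ for $j\ne i$, and $K_{ii}=\mathrm{blk}(0,L_{ii}+\sum_{j\neq i}L_{ij})$; put $K_{i0}=\mathrm{blk}(0,L_{ii})$. In both cases $K_{ii}=K_{i0}-\sum_{j\ne i}K_{ij}$. **$L_2$-stability.** A system $\dot x=f(x,u)$, $y=h(x,u)$ is finite-gain $L_2$-stable with $L_2$-gain $\gamma$ if it is equilibrium-independent dissipative with supply rate $\gamma^2|u|^2-|y|^2$: there is a $C^1$ function $V(x,x^*)$, with $V(x^*,x^*)=0$ and $V(x,x^*)>0$ for $x\ne x^*$, such that $\nabla_xV(x,x^*)f(x,u)\le\gamma^2|u-u^*|^2-|h(x,u)-h(x^*,u^*)|^2$ for all $x,u$ and all equilibria $x^*$ (states with a unique $u^*$ such that $f(x^*,u^*)=0$); and if moreover $\int_0^T|y|^2dt\le\gamma^2\int_0^T|u|^2dt+\beta(x(0))$ for all $T\ge0$ along all solutions with locally square integrable input, for some $\beta\ge0$ with $\beta(0)=0$. **Decentralized design.** Let $\bar\gamma>0$ and $\bar p_1,\dots,\bar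 p_N>0$ be prespecified. For $i=1,\dots,N$ in turn, vehicle $i$ does the following. 1. It chooses a solution $(\tilde L_{ii},P_i,\nu_i,\tilde\rho_i,\tilde\gamma_i)$ of the local LMI problem $$P_i>0,\quad\begin{bmatrix}\tilde\rho_iI&P_i&0\\P_i&-\mathcal H(AP_i+B\tilde L_{ii})&-I+\tfrac12P_i\\0&-I+\tfrac12P_i&-\nu_iI\end{bmatrix}>0,\quad-\frac{\tilde\gamma_i}{\bar p_i}<\nu_i<0,\quad0<\tilde\rho_i<\min\Big\{\bar p_i,\frac{4\tilde\gamma_i}{\bar p_i}\Big\},$$ where $\mathcal H(M)=M+M^\top$, and sets $\rho_i=1/\tilde\rho_i$, $\bar L_{ii}=\tilde L_{ii}P_i^{-1}$. 2. It chooses $p_i,\hat\gamma_i\in\mathbb{R}$ and $3\times 3$ blocks $Q_{ii}$ and $Q_{ij},Q_{ji}$ ($j<i$), feasible (in particular: optimal for any objective function) for $$p_i>0,\qquad\hat\gamma_i<\bar\gamma,\qquad\tilde W_{ii}>0,$$ where the $Q$-blocks have the structure of the $K$-blocks (in case I, $Q_{ii}=\mathrm{blk}(\kappa,\ell)$ and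 off-diagonal blocks $\mathrm{blk}(\kappa,0)$; in case II, all blocks $\mathrm{blk}(0,\ell)$). Here, with $\mathsf e_{ij}=1$ if $i=j$ and $0$ otherwise, $V_i=-p_i\nu_iI$, $R_i=-p_i\rho_iI$, $S_i=-\frac1{2\nu_i}I$, $$W_{ij}=\begin{bmatrix}\mathsf e_{ij}V_i&0&Q_{ij}&\mathsf e_{ij}V_i\\0&\mathsf e_{ij}I&\mathsf e_{ij}I&0\\Q_{ji}^\top&\mathsf e_{ij}I&-Q_{ji}^\top S_j-S_iQ_{ij}-\mathsf e_{ij}R_i&-\mathsf e_{ij}S_iV_i\\\mathsf e_{ij}V_i&0&-\mathsf e_{ij}V_iS_j&\hat\gamma_i\mathsf e_{ij}I\end{bmatrix},$$ and recursively $\tilde W_i=[\tilde W_{ij}]_{j<i}=[W_{ij}]_{j<i}(\mathcal D_i\mathcal A_i^\top)^{-1}$, $\tilde W_{ii}=W_{ii}-\tilde W_i\mathcal D_i\tilde W_i^\top$, with $\mathcal D_i=\mathrm{diag}(\tilde W_{jj}^{-1}:j<i)$ and $\mathcal A_i$ the block lower-triangular matrix formed from $[\tilde W_{kl}]_{k,l<i}$.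 It sets $K_{ii}=V_i^{-1}Q_{ii}$, and $K_{ij}=V_i^{-1}Q_{ij}$, $K_{ji}=V_j^{-1}Q_{ji}$ for $j<i$, and initializes $K_{i0}:=K_{ii}+\sum_{j<i}K_{ij}$. 3. The update $K_{j0}:=K_{j0}+K_{ji}$ is made at each earlier vehicle $j<i$ with $K_{ji}\neq0$. **Theorem.** Suppose that all the above problems are solved at the vehicles $1,\dots,N$. Then for every $n\le N$ (in particular $n=N$): (a) the blocks $K_{ij}$ ($i\ne j$) and $K_{i0}$, $i,j\le n$, held after step $n$ are those of exactly one choice of controller gains for the platoon of the vehicles $1,\dots,n$, and the coupling blocks that these gains produce, including the diagonal ones, are the designed blocks $K_{ij}$; (b) the closed-loop error dynamics of this platoon are finite-gain $L_2$-stable from $w$ to $z$ with some $L_2$-gain $\gamma>0$ with $\gamma^2<\bar\gamma$. Moreover, the design is compositional: for every $n$, whether the choices of the vehicles $1,\dots,n$ are feasible, and which controller gains result after step $n$, depends only on the choices of these vehicles. -/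

import Mathlib

namespace Platoon

open MeasureTheory Set

/-! ### Dynamic systems, equilibrium-independent dissipativity, `L₂`-gain -/

/-- A system `ẋ = f (x, u)`, `y = h (x, u)` with states in `ℝⁿ`, inputs in `ℝ^q`, outputs in `ℝᵐ`
(`n`, `q`, `m` are index types). -/
structure Sys (n q m : Type) where
  f : (n → ℝ) → (q → ℝ) → (n → ℝ)
  h : (n → ℝ) → (q → ℝ) → (m → ℝ)

section Systems

variable {n q m : Type} [Fintype n] [Fintype q] [Fintype m]

/-- The equilibrium states: those `x*` with exactly one `u*` such that `f (x*, u*) = 0`. -/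
def Sys.equilibria (S : Sys n q m) : Set (n → ℝ) :=
  {xs | ∃! us, S.f xs us = 0}

/-- Equilibrium-independent dissipativity (EID) under the supply rate `s`, with respect to all
equilibrium states. -/
def Sys.IsEID (S : Sys n q m) (s : (q → ℝ) → (m → ℝ) → ℝ) : Prop :=
  ∃ V : (n → ℝ) → (n → ℝ) → ℝ,
    ContDiffOn ℝ 1 (fun a : (n → ℝ) × (n → ℝ) => V a.1 a.2) (univ ×ˢ S.equilibria) ∧
    ∀ xs ∈ S.equilibria, ∀ us, S.f xs us = 0 →
      V xs xs = 0 ∧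
      (∀ x, x ≠ xs → 0 < V x xs) ∧
      ∀ x u, fderiv ℝ (fun x' => V x' xs) x (S.f x u) ≤ s (u - us) (S.h x u - S.h xs us)

/-- `X`-EID: EID under the quadratic supply rate with coefficient matrix `X`. -/
def Sys.IsXEID (S : Sys n q m) (X : Matrix (q ⊕ m) (q ⊕ m) ℝ) : Prop :=
  S.IsEID fun u y => Sum.elim u y ⬝ᵥ X.mulVec (Sum.elim u y)

/-- `x` is a (Carathéodory) solution on `[0, ∞)` for the input `u`. -/
structure Sys.IsSolution (S : Sys n q m) (x : ℝ → n → ℝ) (u : ℝ → q → ℝ) : Prop where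
  integrable : ∀ t, 0 ≤ t → ∀ i,
    IntervalIntegrable (fun s => S.f (x s) (u s) i) volume 0 t
  eq : ∀ t, 0 ≤ t → ∀ i, x t i = x 0 i + ∫ s in (0 : ℝ)..t, S.f (x s) (u s) i

/-- The input-output form of `L₂`-stability with `L₂`-gain at most `γ`: along every solution with a
locally square integrable input, `∫₀ᵀ |y|² ≤ γ² ∫₀ᵀ |u|² + β (x 0)`, with a bias `β ≥ 0` that depends
only on the initial state and vanishes at `0`. -/
def Sys.HasL2Gain (S : Sys n q m) (γ : ℝ) : Prop :=
  ∃ β : (n → ℝ) → ℝ, β 0 = 0 ∧ (∀ x₀, 0 ≤ β x₀) ∧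
    ∀ (x : ℝ → n → ℝ) (u : ℝ → q → ℝ), S.IsSolution x u →
      (∀ T, 0 ≤ T → ∀ i, MemLp (fun t => u t i) 2 (volume.restrict (Icc 0 T))) →
      ∀ T, 0 ≤ T →
        IntervalIntegrable (fun t => ∑ i, S.h (x t) (u t) i ^ 2) volume 0 T ∧
        ∫ t in (0 : ℝ)..T, ∑ i, S.h (x t) (u t) i ^ 2 ≤
          γ ^ 2 * (∫ t in (0 : ℝ)..T, ∑ i, u t i ^ 2) + β (x 0)

/-- Finite-gain `L₂`-stability with `L₂`-gain `γ`: `X`-EID for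
`X = [γ² I, 0; 0, -I]`, together with its input-output form. -/
def Sys.FiniteGainL2Stable [DecidableEq q] [DecidableEq m] (S : Sys n q m) (γ : ℝ) : Prop :=
  S.IsXEID (Matrix.fromBlocks (γ ^ 2 • 1) 0 0 (-1)) ∧ S.HasL2Gain γ

end Systems

/-! ### The platoon error dynamics -/

/-- `3 × 3` blocks; a vehicle error is `(location error, velocity error, acceleration error)`. -/
abbrev Blk := Matrix (Fin 3) (Fin 3) ℝ

def A : Blk := !![0, 1, 0; 0, 0, 1; 0, 0, 0]

def B : Matrix (Fin 3) (Fin 1) ℝ := !![0; 0; 1]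

/-- The block with entry `κ` in place (velocity, acceleration) and last row `l`. -/
def blk (κ : ℝ) (l : Fin 3 → ℝ) : Blk := !![0, 0, 0; 0, 0, κ; l 0, l 1, l 2]

/-- The two formulations of the error dynamics: `I` (location and velocity errors are weighted sums
over all vehicles) and `II` (all errors are relative to the leader). -/
inductive Formulation where
  | I
  | II

/-- Global controller gains under formulation I: weights `k̄ᵢⱼ`, weights `k̄ᵢ₀` of the leader, and
`Lᵢᵢ`. -/
@[ext]
structure GainsI (N : ℕ) where
  kbar : Fin N → Fin N → ℝ
  kbar_self : ∀ i, kbar i i = 0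
  kbar0 : Fin N → ℝ
  L : Fin N → Fin 3 → ℝ

/-- Global controller gains under formulation II: `uᵢ = Lᵢᵢ eᵢ + ∑_{j ≠ i} Lᵢⱼ (eᵢ - eⱼ)`. -/
@[ext]
structure GainsII (N : ℕ) where
  L : Fin N → Fin N → Fin 3 → ℝ

def Gains : Formulation → ℕ → Type
  | .I, N => GainsI N
  | .II, N => GainsII N

/-- The coefficients `kᵢᵢ = k̄ᵢ₀ + ∑ⱼ k̄ᵢⱼ` and `kᵢⱼ = -k̄ᵢⱼ` for `j ≠ i`. -/
def GainsI.k {N : ℕ} (c : GainsI N) (i j : Fin N) : ℝ :=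
  if i = j then c.kbar0 i + ∑ l, c.kbar i l else -c.kbar i j

/-- The rows `K̄ᵢᵢ = Lᵢᵢ + ∑_{j ≠ i} Lᵢⱼ` and `K̄ᵢⱼ = -Lᵢⱼ` for `j ≠ i`. -/
def GainsII.Kbar {N : ℕ} (c : GainsII N) (i j : Fin N) : Fin 3 → ℝ :=
  if i = j then c.L i i + ∑ l ∈ Finset.univ.erase i, c.L i l else -c.L i j

/-- The coupling blocks `Kᵢⱼ` of the closed-loop error dynamics that the gains produce. -/
def Gains.coupling {N : ℕ} : (φ : Formulation) → Gains φ N → Fin N → Fin N → Blk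
  | .I, c, i, j =>
      blk (GainsI.k c i j - if i = j then 1 else 0) (if i = j then GainsI.L c i else 0)
  | .II, c, i, j => blk 0 (GainsII.Kbar c i j)

/-- The block `Kᵢⱼ`, `i ≠ j`, that the gains of vehicle `i` for its link from `j` encode. -/
def Gains.link {N : ℕ} : (φ : Formulation) → Gains φ N → Fin N → Fin N → Blk
  | .I, c, i, j => blk (-GainsI.kbar c i j) 0
  | .II, c, i, j => blk 0 (-GainsII.L c i j)

/-- The block `Kᵢ₀` that the leader-related gains of vehicle `i` encode. -/
def Gains.leader {N : ℕ} : (φ : Formulation) → Gains φ N → Fin N → Blk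
  | .I, c, i => blk (GainsI.kbar0 c i - 1) (GainsI.L c i)
  | .II, c, i => blk 0 (GainsII.L c i i)

/-- The networked system `ėᵢ = (A + B L̄ᵢᵢ) eᵢ + ηᵢ`, `ηᵢ = ∑ⱼ Kᵢⱼ eⱼ + wᵢ`, `zᵢ = eᵢ`, with
disturbance input `w` and performance output `z`. -/
def errorDynamics {N : ℕ} (Lbar : Fin N → Matrix (Fin 1) (Fin 3) ℝ) (K : Fin N → Fin N → Blk) :
    Sys (Fin N × Fin 3) (Fin N × Fin 3) (Fin N × Fin 3) where
  f e w := fun a =>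
    (A + B * Lbar a.1).mulVec (fun s => e (a.1, s)) a.2 +
      (∑ j, (K a.1 j).mulVec (fun s => e (j, s)) a.2 + w a)
  h e _ := e

/-! ### The sequential decomposition of a symmetric block matrix -/

/-- The blocks `W̃ᵢⱼ`, `j ≤ i`, of a block matrix `W = [Wᵢⱼ]` (and `0` for `j > i`):
`W̃ᵢ = [W̃ᵢⱼ]_{j < i} = Wᵢ (Dᵢ Aᵢᵀ)⁻¹` and `W̃ᵢᵢ = Wᵢᵢ - W̃ᵢ Dᵢ W̃ᵢᵀ`, where `Wᵢ = [Wᵢⱼ]_{j < i}`,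
`Dᵢ = diag (W̃ⱼⱼ⁻¹ : j < i)`, and `Aᵢ` is the block lower-triangular matrix of `[W̃ₖₗ]_{k, l < i}`. -/
noncomputable def tilde {m : Type} [Fintype m] [DecidableEq m] (W : ℕ → ℕ → Matrix m m ℝ) (i : ℕ) :
    ℕ → Matrix m m ℝ :=
  let lowerTri : Matrix (Fin i × m) (Fin i × m) ℝ :=
    Matrix.comp _ _ _ _ ℝ (Matrix.of fun k l : Fin i => if l ≤ k then tilde W k l else 0)
  let D : Matrix (Fin i × m) (Fin i × m) ℝ :=
    Matrix.comp _ _ _ _ ℝ (Matrix.diagonal fun k : Fin i => (tilde W k k)⁻¹)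
  let Wi : Matrix m (Fin i × m) ℝ := Matrix.of fun r a => W i a.1 r a.2
  let Wt : Matrix m (Fin i × m) ℝ := Wi * (D * lowerTri.transpose)⁻¹
  fun j =>
    if hj : j < i then Matrix.of fun r s => Wt r (⟨j, hj⟩, s)
    else if j = i then W i i - Wt * D * Wt.transpose
    else 0
termination_by i
decreasing_by all_goals exact k.isLt

/-! ### The decentralized design -/

/-- The variables of the local controller design at one vehicle. -/
structure LocalVars where
  Ltil : Matrix (Fin 1) (Fin 3) ℝ
  P : Blk
  ν : ℝ
  ρtil : ℝ
  γtil : ℝ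

namespace LocalVars

/-- The passivity index `ρ = 1 / ρ̃`. -/
noncomputable def ρ (d : LocalVars) : ℝ := 1 / d.ρtil

/-- The local controller gain `L̄ = L̃ P⁻¹`. -/
noncomputable def Lbar (d : LocalVars) : Matrix (Fin 1) (Fin 3) ℝ := d.Ltil * d.P⁻¹

/-- The `3 × 3` array of `3 × 3` blocks of the local LMI. -/
noncomputable def lmiBlocks (d : LocalVars) : Matrix (Fin 3) (Fin 3) Blk :=
  !![d.ρtil • (1 : Blk), d.P, 0;
     d.P, -((A * d.P + B * d.Ltil) + (A * d.P + B * d.Ltil).transpose), -1 + (1 / 2 : ℝ) • d.P;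
     0, -1 + (1 / 2 : ℝ) • d.P, -d.ν • (1 : Blk)]

/-- The local LMI problem with prespecified parameter `p`. -/
structure Feasible (d : LocalVars) (p : ℝ) : Prop where
  P_pos : d.P.PosDef
  lmi_pos : (Matrix.comp _ _ _ _ ℝ d.lmiBlocks).PosDef
  ν_lower : -d.γtil / p < d.ν
  ν_neg : d.ν < 0
  ρtil_pos : 0 < d.ρtil
  ρtil_lt : d.ρtil < min p (4 * d.γtil / p)

end LocalVars

/-- The variables of the vehicle-by-vehicle design; vehicles are numbered `0, 1, 2, …`, and vehicle
`i` chooses `loc i`, `p i`, `γhat i`, `Q i i`, and `Q i j`, `Q j i` for `j < i`. -/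
structure Design where
  loc : ℕ → LocalVars
  Q : ℕ → ℕ → Blk
  p : ℕ → ℝ
  γhat : ℕ → ℝ

namespace Design

variable (D : Design)

/-- `V_p^{ii} = -pᵢ νᵢ I`. -/
def V (i : ℕ) : Blk := -(D.p i * (D.loc i).ν) • (1 : Blk)

/-- `R_p^{ii} = -pᵢ ρᵢ I`. -/
noncomputable def R (i : ℕ) : Blk := -(D.p i * (D.loc i).ρ) • (1 : Blk)

/-- `S_{ii} = -1 / (2 νᵢ) I`. -/
noncomputable def S (i : ℕ) : Blk := -(1 / (2 * (D.loc i).ν)) • (1 : Blk)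

/-- The `4 × 4` array of `3 × 3` blocks that makes up `Wᵢⱼ`. -/
noncomputable def Wblocks (i j : ℕ) : Matrix (Fin 4) (Fin 4) Blk :=
  let e : ℝ := if i = j then 1 else 0
  !![e • D.V i, 0, D.Q i j, e • D.V i;
     0, e • 1, e • 1, 0;
     (D.Q j i).transpose, e • 1,
       -((D.Q j i).transpose * D.S j) - D.S i * D.Q i j - e • D.R i, -(e • (D.S i * D.V i));
     e • D.V i, 0, -(e • (D.V i * D.S j)), (D.γhat i * e) • 1]

/-- The blocks `Wᵢⱼ`. -/
noncomputable def W (i j : ℕ) : Matrix (Fin 4 × Fin 3) (Fin 4 × Fin 3) ℝ :=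
  Matrix.comp _ _ _ _ ℝ (D.Wblocks i j)

/-- The blocks `Kᵢⱼ = (V_p^{ii})⁻¹ Qᵢⱼ`. -/
noncomputable def K (i j : ℕ) : Blk := (D.V i)⁻¹ * D.Q i j

/-- The zero pattern of the coupling blocks, `Q` having to share the structure of `[Kᵢⱼ]`. -/
def Structured (φ : Formulation) (i j : ℕ) : Prop :=
  match φ with
  | .I => if i = j then ∃ κ l, D.Q i j = blk κ l else ∃ κ, D.Q i j = blk κ 0
  | .II => ∃ l, D.Q i j = blk 0 l

/-- The choices of vehicle `i` solve its two design problems: the local LMI problem with the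
prespecified parameter `pbar`, and then the LMI problem for its coupling blocks. -/
structure StepFeasible (φ : Formulation) (pbar γbar : ℝ) (i : ℕ) : Prop where
  localLMI : (D.loc i).Feasible pbar
  structured_self : D.Structured φ i i
  structured : ∀ j < i, D.Structured φ i j ∧ D.Structured φ j i
  p_pos : 0 < D.p i
  γhat_lt : D.γhat i < γbar
  tilde_pos : (tilde D.W i i).PosDef

open Classical in
/-- The block `K_{j0}` held by vehicle `j` after the first `n` vehicles have been designed. When
vehicle `n` is designed, it initializes `K_{n0}` so that `K_{nn} = K_{n0} - ∑_{l < n} K_{nl}`, and the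
update `K_{j0} := K_{j0} + K_{jn}` is made at every earlier vehicle `j` that receives information
from vehicle `n`; nothing else changes. -/
noncomputable def leaderBlk : (n : ℕ) → (j : ℕ) → Blk
  | 0, _ => 0
  | n + 1, j =>
      if j = n then D.K n n + ∑ l ∈ Finset.range n, D.K n l
      else if j < n ∧ D.K j n ≠ 0 then leaderBlk n j + D.K j n
      else leaderBlk n j

/-- The gains `c` of a platoon of `n` vehicles encode the blocks held after `n` design steps. -/
structure Realizes (φ : Formulation) (n : ℕ) (c : Gains φ n) : Prop where
  link : ∀ i j : Fin n, i ≠ j → Gains.link φ c i j = D.K i j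
  leader : ∀ i : Fin n, Gains.leader φ c i = D.leaderBlk n i

/-- The closed-loop error dynamics of the platoon of the first `n` vehicles with global controller
gains `c` and the designed local controller gains. -/
noncomputable def closedLoop (φ : Formulation) (n : ℕ) (c : Gains φ n) :
    Sys (Fin n × Fin 3) (Fin n × Fin 3) (Fin n × Fin 3) :=
  errorDynamics (fun i => (D.loc i).Lbar) (Gains.coupling φ c)

/-- Two designs make the same choices at the first `n` vehicles. -/
structure AgreeOn (D' : Design) (n : ℕ) : Prop where
  loc : ∀ i < n, D.loc i = D'.loc i
  Q : ∀ i < n, ∀ j < n, D.Q i j = D'.Q i j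
  p : ∀ i < n, D.p i = D'.p i
  γhat : ∀ i < n, D.γhat i = D'.γhat i

end Design

end Platoon

/-! The recursion defining `tilde` is a block LDLᵀ factorization: with `A` the lower-triangular
matrix of the blocks W̃ₖₗ and `D = diag(W̃ₖₖ⁻¹)` it gives `W = A D Aᵀ` (`eq_sum_tilde`). Positive
definite pivots, each checked by one vehicle, therefore make the global matrix `W` positive
semidefinite.

The local LMI makes vehicle i dissipative with storage xᵀPᵢ⁻¹x and supply -νᵢ|η|² + η·x - ρᵢ|x|²
(`LocalVars.Feasible.dissipation`). Evaluating the form of `W` at the vectors (-ηᵢ, -xᵢ, xᵢ, wᵢ),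
where η is the interconnection signal, shows that these supplies, weighted by pᵢ, sum to at most
Σ(γ̂ᵢ|wᵢ|² - |xᵢ|²) (`sum_supply_le`). Hence Σ pᵢ xᵢᵀPᵢ⁻¹xᵢ is a quadratic storage function for the
whole platoon. Linearity transfers the inequality to every equilibrium, and integration gives the
input-output bound.

For the gains, `leaderBlk` always holds the row sum of the blocks `K`, so links and leader blocks
determine the gains and reproduce the diagonal blocks. Compositionality holds because row i of the
recursion reads only blocks with indices at most i. -/

namespace Platoon

open MeasureTheory Set

/-! ### Block LDLᵀ factorization and positivity -/

section Tilde

open Matrix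

variable {m : Type} [Fintype m] [DecidableEq m] {W W' : ℕ → ℕ → Matrix m m ℝ}

theorem tilde_of_lt {i j : ℕ} (h : i < j) : tilde W i j = 0 := by
  rw [tilde]
  simp [h.not_gt, h.ne']

/-- Row i of the recursion uses only row i of `W` up to the diagonal and the earlier rows of
`tilde`. This is what makes the design compositional. -/
theorem tilde_congr {n : ℕ} (h : ∀ i < n, ∀ j < n, W i j = W' i j) (i : ℕ) (hi : i < n) :
    tilde W i = tilde W' i := by
  induction i using Nat.strong_induction_on with
  | _ i ih =>
    have ih' : ∀ k : Fin i, tilde W k = tilde W' k := fun k => ih k k.2 (k.2.trans hi)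
    have hW : ∀ k : Fin i, W i k = W' i k := fun k => h i hi k (k.2.trans hi)
    rw [tilde, tilde]
    simp only [ih', hW, h i hi i hi]

/-- Both defining relations of the decomposition: row `i` of `W` is row `i` of `A D Aᵀ`. -/
theorem eq_sum_tilde_of_le {i : ℕ} (hT : ∀ k < i, IsUnit (tilde W k k))
    (hTs : (tilde W i i).IsSymm) (hu : IsUnit (tilde W i i)) {j : ℕ} (hj : j ≤ i) :
    W i j = ∑ k ∈ Finset.range (i + 1), tilde W i k * (tilde W k k)⁻¹ * (tilde W j k)ᵀ := by
  set lowerTri : Matrix (Fin i) (Fin i) (Matrix m m ℝ) :=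
    Matrix.of fun k l : Fin i => if l ≤ k then tilde W k l else 0 with hL
  set D : Matrix (Fin i) (Fin i) (Matrix m m ℝ) :=
    Matrix.diagonal fun k : Fin i => (tilde W k k)⁻¹ with hD
  set Wi : Matrix m (Fin i × m) ℝ := Matrix.of fun r a => W i a.1 r a.2 with hWi
  set C : Matrix (Fin i × m) (Fin i × m) ℝ :=
    Matrix.comp _ _ _ _ ℝ D * (Matrix.comp _ _ _ _ ℝ lowerTri)ᵀ with hC
  have hrow : ∀ k : Fin i, ∀ r s, (Wi * C⁻¹) r (k, s) = tilde W i k r s := by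
    intro k r s
    conv_rhs => rw [tilde]
    simp only [k.2, dite_true]
    rfl
  have hdiag : tilde W i i = W i i - Wi * C⁻¹ * Matrix.comp _ _ _ _ ℝ D * (Wi * C⁻¹)ᵀ := by
    conv_lhs => rw [tilde]
    simp only [lt_irrefl, dite_false, if_true]
    rfl
  have hDu : IsUnit (Matrix.comp _ _ _ _ ℝ D) := by
    rw [isUnit_comp_iff]
    refine ⟨⟨D, Matrix.diagonal fun k : Fin i => tilde W k k, ?_, ?_⟩, rfl⟩
    · rw [hD, Matrix.diagonal_mul_diagonal, ← Matrix.diagonal_one]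
      congr 1; funext k
      exact Matrix.nonsing_inv_mul _ ((Matrix.isUnit_iff_isUnit_det _).1 (hT k k.2))
    · rw [hD, Matrix.diagonal_mul_diagonal, ← Matrix.diagonal_one]
      congr 1; funext k
      exact Matrix.mul_nonsing_inv _ ((Matrix.isUnit_iff_isUnit_det _).1 (hT k k.2))
  -- The transpose is block upper triangular, so its determinant is the product of those of the
  -- transposed pivots.
  have hLu : IsUnit (Matrix.comp _ _ _ _ ℝ lowerTri)ᵀ := by
    have htri : (Matrix.comp _ _ _ _ ℝ lowerTri)ᵀ.BlockTriangular Prod.fst := by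
      rintro ⟨a, r⟩ ⟨b, s⟩ (hab : b < a)
      simp [hL, hab.not_ge]
    rw [Matrix.isUnit_iff_isUnit_det, htri.det_fintype, IsUnit.prod_univ_iff]
    intro k
    have : (((Matrix.comp _ _ _ _ ℝ lowerTri)ᵀ).toSquareBlock Prod.fst k).det =
        ((tilde W k k)ᵀ).det := by
      let e : m ≃ {a : Fin i × m // a.1 = k} :=
        ⟨fun r => ⟨(k, r), rfl⟩, fun a => a.1.2, fun _ => rfl, by rintro ⟨⟨a, r⟩, rfl⟩; rfl⟩
      rw [← Matrix.det_submatrix_equiv_self e]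
      congr 1
      ext r s
      simp [e, hL, Matrix.toSquareBlock_def]
    rw [this, Matrix.det_transpose]
    exact (Matrix.isUnit_iff_isUnit_det _).1 (hT k k.2)
  have hCu : IsUnit C.det := (Matrix.isUnit_iff_isUnit_det _).1 (hDu.mul hLu)
  have hmulD : ∀ r (k : Fin i) s, (Wi * C⁻¹ * Matrix.comp _ _ _ _ ℝ D) r (k, s) =
      (tilde W i k * (tilde W k k)⁻¹) r s := by
    intro r k s
    rw [Matrix.mul_apply, Fintype.sum_prod_type, Finset.sum_eq_single k]
    · simp only [hrow, Matrix.comp_apply, hD, Matrix.diagonal_apply_eq, Matrix.mul_apply]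
    · intro b _ hb
      simp [hD, Matrix.diagonal_apply_ne _ hb]
    · simp
  rw [Finset.sum_range_succ]
  rcases hj.lt_or_eq with hj | rfl
  -- Below the diagonal the term k = i vanishes, and the remaining ones are block j of `Wi = (Wi *
  -- C⁻¹) * C`.
  · rw [tilde_of_lt hj]
    have hWeq : Wi = Wi * C⁻¹ * Matrix.comp _ _ _ _ ℝ D * (Matrix.comp _ _ _ _ ℝ lowerTri)ᵀ := by
      rw [Matrix.mul_assoc, ← hC, Matrix.mul_assoc, Matrix.nonsing_inv_mul _ hCu, Matrix.mul_one]
    ext r s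
    have : W i j r s = Wi r (⟨j, hj⟩, s) := rfl
    rw [this, hWeq, Matrix.mul_apply, Fintype.sum_prod_type]
    simp only [hmulD, Matrix.transpose_zero, Matrix.mul_zero, add_zero, Matrix.sum_apply,
      ← Fin.sum_univ_eq_sum_range (fun k => (tilde W i k * (tilde W k k)⁻¹ * (tilde W j k)ᵀ) r s) i]
    refine Finset.sum_congr rfl fun k _ => ?_
    rw [Matrix.mul_apply]
    refine Finset.sum_congr rfl fun t _ => ?_
    congr 1
    simp only [Matrix.transpose_apply, Matrix.comp_apply, hL, Matrix.of_apply]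
    split_ifs with hk
    · rfl
    · rw [tilde_of_lt (by simpa [Fin.le_def] using hk)]
  -- On the diagonal the term k = i collapses to the symmetric pivot itself, which is the Schur
  -- complement of the other terms.
  · rw [Matrix.mul_nonsing_inv _ ((Matrix.isUnit_iff_isUnit_det _).1 hu), Matrix.one_mul, hTs.eq]
    have hW : W j j = Wi * C⁻¹ * Matrix.comp _ _ _ _ ℝ D * (Wi * C⁻¹)ᵀ + tilde W j j := by
      rw [hdiag]; abel
    rw [hW]
    congr 1
    ext r s
    rw [Matrix.mul_apply, Fintype.sum_prod_type]
    simp only [hmulD, Matrix.sum_apply,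
      ← Fin.sum_univ_eq_sum_range (fun k => (tilde W j k * (tilde W k k)⁻¹ * (tilde W j k)ᵀ) r s) j]
    refine Finset.sum_congr rfl fun k _ => ?_
    rw [Matrix.mul_apply]
    refine Finset.sum_congr rfl fun t _ => ?_
    rw [Matrix.transpose_apply, hrow, Matrix.transpose_apply]

/-- On and below the diagonal the sum extends to all k < n because `tilde` vanishes above the
diagonal; the upper half follows by transposition. -/
theorem eq_sum_tilde {n : ℕ} (hW : ∀ i j, (W i j)ᵀ = W j i)
    (hT : ∀ k < n, (tilde W k k).PosDef) {i j : ℕ} (hi : i < n) (hj : j < n) :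
    W i j = ∑ k ∈ Finset.range n, tilde W i k * (tilde W k k)⁻¹ * (tilde W j k)ᵀ := by
  have hsymm : ∀ k < n, (tilde W k k).IsSymm := fun k hk => by
    simpa [Matrix.IsHermitian, Matrix.IsSymm] using (hT k hk).isHermitian
  have key : ∀ i < n, ∀ j ≤ i,
      W i j = ∑ k ∈ Finset.range n, tilde W i k * (tilde W k k)⁻¹ * (tilde W j k)ᵀ := by
    intro i hi j hj
    rw [eq_sum_tilde_of_le (fun k hk => (hT k (hk.trans hi)).isUnit) (hsymm i hi)
      (hT i hi).isUnit hj]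
    refine Finset.sum_subset (by simpa using hi) fun k _ hk => ?_
    rw [tilde_of_lt (i := i) (by simpa [Nat.lt_succ_iff] using hk)]
    simp
  rcases le_total j i with h | h
  · exact key i hi j h
  · rw [← hW j i, key j hj i h, Matrix.transpose_sum]
    refine Finset.sum_congr rfl fun k hk => ?_
    rw [Matrix.transpose_mul, Matrix.transpose_mul, Matrix.transpose_transpose,
      Matrix.transpose_nonsing_inv, (hsymm k (by simpa using hk)).eq, Matrix.mul_assoc]

/-- If all the pivots `W̃ₖₖ` are positive definite, then `W` is positive semidefinite. -/
theorem sum_dotProduct_nonneg_of_tilde_posDef {n : ℕ} (hW : ∀ i j, (W i j)ᵀ = W j i)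
    (hT : ∀ k < n, (tilde W k k).PosDef) (v : Fin n → m → ℝ) :
    0 ≤ ∑ i : Fin n, ∑ j : Fin n, v i ⬝ᵥ W i j *ᵥ v j := by
  have h : ∀ i j : Fin n, v i ⬝ᵥ W i j *ᵥ v j = ∑ k ∈ Finset.range n,
      ((tilde W i k)ᵀ *ᵥ v i) ⬝ᵥ (tilde W k k)⁻¹ *ᵥ ((tilde W j k)ᵀ *ᵥ v j) := by
    intro i j
    rw [eq_sum_tilde hW hT i.2 j.2, Matrix.sum_mulVec, dotProduct_sum]
    refine Finset.sum_congr rfl fun k _ => ?_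
    rw [Matrix.mulVec_transpose, ← Matrix.dotProduct_mulVec, Matrix.mulVec_mulVec,
      Matrix.mulVec_mulVec, Matrix.mul_assoc]
  -- Grouping by pivot turns the double sum into a sum of forms of W̃ₖₖ⁻¹, each at the single vector
  -- Σᵢ W̃ᵢₖᵀvᵢ.
  have h2 : ∑ i : Fin n, ∑ j : Fin n, v i ⬝ᵥ W i j *ᵥ v j = ∑ k ∈ Finset.range n,
      (∑ i : Fin n, (tilde W i k)ᵀ *ᵥ v i) ⬝ᵥ
        (tilde W k k)⁻¹ *ᵥ (∑ j : Fin n, (tilde W j k)ᵀ *ᵥ v j) := by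
    simp only [h, Matrix.mulVec_sum, dotProduct_sum, sum_dotProduct]
    rw [Finset.sum_comm, Finset.sum_comm (s := Finset.range n)]
    exact Finset.sum_congr rfl fun j _ => Finset.sum_comm
  rw [h2]
  refine Finset.sum_nonneg fun k hk => ?_
  simpa using (hT k (by simpa using hk)).inv.posSemidef.dotProduct_mulVec_nonneg
    (∑ i : Fin n, (tilde W i k)ᵀ *ᵥ v i)

end Tilde

/-! ### From quadratic storage functions to finite-gain stability -/

section QuadraticStorage

open Matrix

/-- The product rule, in integrated form, for indefinite integrals of integrable functions. -/
theorem integral_mul_add_mul_of_eq_integral {x y f g : ℝ → ℝ} {a b : ℝ} (hab : a ≤ b)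
    (hf : IntervalIntegrable f volume a b) (hg : IntervalIntegrable g volume a b)
    (hx : ∀ t ∈ Icc a b, x t = x a + ∫ s in a..t, f s)
    (hy : ∀ t ∈ Icc a b, y t = y a + ∫ s in a..t, g s) :
    IntervalIntegrable (fun t => f t * y t + x t * g t) volume a b ∧
      ∫ t in a..b, (f t * y t + x t * g t) = x b * y b - x a * y a := by
  have hac : ∀ {f : ℝ → ℝ} (c : ℝ), IntervalIntegrable f volume a b →
      AbsolutelyContinuousOnInterval (fun t => c + ∫ s in a..t, f s) a b := fun c hf =>
    ((contDiff_const.contDiffOn (s := uIcc a b)).absolutelyContinuousOnInterval).fun_add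
      (hf.absolutelyContinuousOnInterval_intervalIntegral left_mem_uIcc)
  have hX := hac (x a) hf
  have hY := hac (y a) hg
  have hX' : ContinuousOn x (uIcc a b) := hX.continuousOn.congr (by rwa [uIcc_of_le hab])
  have hY' : ContinuousOn y (uIcc a b) := hY.continuousOn.congr (by rwa [uIcc_of_le hab])
  refine ⟨(hf.mul_continuousOn hY').add (hg.continuousOn_mul hX'), ?_⟩
  have h := hX.integral_deriv_mul_eq_sub hY
  simp only [← hx b (right_mem_Icc.2 hab), ← hy b (right_mem_Icc.2 hab),
    intervalIntegral.integral_same, add_zero] at h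
  rw [← h]
  refine intervalIntegral.integral_congr_ae ?_
  -- By Lebesgue differentiation the primitives have derivatives `f` and `g` almost everywhere,
  -- which suffices under the integral.
  filter_upwards [hf.ae_hasDerivAt_integral, hg.ae_hasDerivAt_integral] with t htf htg ht
  have ht' : t ∈ uIcc a b := uIoc_subset_uIcc ht
  have ht'' : t ∈ Icc a b := by rwa [uIcc_of_le hab] at ht'
  rw [((htf ht' a left_mem_uIcc).const_add (x a)).deriv,
    ((htg ht' a left_mem_uIcc).const_add (y a)).deriv, hx t ht'', hy t ht'']

variable {n q : Type} [Fintype n]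

theorem dotProduct_mulVec_comm_of_isSymm {M : Matrix n n ℝ} (hM : M.IsSymm) (x y : n → ℝ) :
    x ⬝ᵥ M *ᵥ y = y ⬝ᵥ M *ᵥ x := by
  rw [Matrix.dotProduct_mulVec, dotProduct_comm, ← Matrix.mulVec_transpose, hM.eq]

variable {S : Sys n q n} {M : Matrix n n ℝ} {γ : ℝ}

/-- A quadratic storage function along a solution. -/
theorem Sys.IsSolution.integral_two_mul_dotProduct {x : ℝ → n → ℝ} {u : ℝ → q → ℝ}
    (h : S.IsSolution x u) (hM : M.IsSymm) {T : ℝ} (hT : 0 ≤ T) :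
    IntervalIntegrable (fun t => 2 * (x t ⬝ᵥ M *ᵥ S.f (x t) (u t))) volume 0 T ∧
      ∫ t in (0 : ℝ)..T, 2 * (x t ⬝ᵥ M *ᵥ S.f (x t) (u t)) =
        x T ⬝ᵥ M *ᵥ x T - x 0 ⬝ᵥ M *ᵥ x 0 := by
  have key := fun i j : n => integral_mul_add_mul_of_eq_integral hT
    (h.integrable T hT i) (h.integrable T hT j) (x := fun t => x t i) (y := fun t => x t j)
    (fun t ht => h.eq t ht.1 i) (fun t ht => h.eq t ht.1 j)
  -- Symmetry of `M` makes each summand the derivative of `M i j * x i * x j`, to which the product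
  -- rule applies.
  have hexp : (fun t => 2 * (x t ⬝ᵥ M *ᵥ S.f (x t) (u t))) = fun t => ∑ i, ∑ j, M i j *
      (S.f (x t) (u t) i * x t j + x t i * S.f (x t) (u t) j) := by
    funext t
    rw [two_mul]
    nth_rewrite 1 [dotProduct_mulVec_comm_of_isSymm hM]
    simp only [dotProduct, Matrix.mulVec, Finset.mul_sum, ← Finset.sum_add_distrib]
    refine Finset.sum_congr rfl fun i _ => Finset.sum_congr rfl fun j _ => ?_
    ring
  have hint : ∀ i j, IntervalIntegrable (fun t => M i j *
      (S.f (x t) (u t) i * x t j + x t i * S.f (x t) (u t) j)) volume 0 T :=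
    fun i j => (key i j).1.const_mul _
  have hint' : ∀ i, IntervalIntegrable (fun t => ∑ j, M i j *
      (S.f (x t) (u t) i * x t j + x t i * S.f (x t) (u t) j)) volume 0 T := fun i => by
    simpa only [Finset.sum_fn] using
      IntervalIntegrable.sum Finset.univ (f := fun j t => M i j *
        (S.f (x t) (u t) i * x t j + x t i * S.f (x t) (u t) j)) fun j _ => hint i j
  rw [hexp]
  constructor
  · simpa only [Finset.sum_fn] using
      IntervalIntegrable.sum Finset.univ (f := fun i t => ∑ j, M i j *
        (S.f (x t) (u t) i * x t j + x t i * S.f (x t) (u t) j)) fun i _ => hint' i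
  · rw [intervalIntegral.integral_finsetSum fun i _ => hint' i]
    simp only [dotProduct, Matrix.mulVec, Finset.mul_sum, ← Finset.sum_sub_distrib]
    refine Finset.sum_congr rfl fun i _ => ?_
    rw [intervalIntegral.integral_finsetSum fun j _ => hint i j]
    refine Finset.sum_congr rfl fun j _ => ?_
    rw [intervalIntegral.integral_const_mul, (key i j).2]
    ring

variable [Fintype q]

/-- Integrate the dissipation inequality along the solution and drop the nonnegative terminal
storage; the initial storage is the bias. -/
theorem Sys.hasL2Gain_of_quadratic (hM : M.PosSemidef) (hh : ∀ x u, S.h x u = x)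
    (hdiss : ∀ x u, 2 * (x ⬝ᵥ M *ᵥ S.f x u) ≤ γ ^ 2 * ∑ i, u i ^ 2 - ∑ i, x i ^ 2) :
    S.HasL2Gain γ := by
  have hsymm : M.IsSymm := by simpa [Matrix.IsHermitian, Matrix.IsSymm] using hM.isHermitian
  have hnn : ∀ x, 0 ≤ x ⬝ᵥ M *ᵥ x := fun x => by simpa using hM.dotProduct_mulVec_nonneg x
  refine ⟨fun x => x ⬝ᵥ M *ᵥ x, by simp, hnn, fun x u hxu hu T hT => ?_⟩
  simp only [hh]
  have hu2 : IntervalIntegrable (fun t => ∑ i, u t i ^ 2) volume 0 T := by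
    rw [intervalIntegrable_iff_integrableOn_Icc_of_le hT]
    exact integrable_finsetSum _ fun i _ => (hu T hT i).integrable_sq
  have hxc : ∀ i, ContinuousOn (fun t => x t i) (uIcc 0 T) := fun i => by
    refine ContinuousOn.congr (f := fun t => x 0 i + ∫ s in (0 : ℝ)..t, S.f (x s) (u s) i)
      (continuousOn_const.add ?_) fun t ht => hxu.eq t (by rw [uIcc_of_le hT] at ht; exact ht.1) i
    exact ((hxu.integrable T hT i).absolutelyContinuousOnInterval_intervalIntegral
      left_mem_uIcc).continuousOn
  have hx2 : IntervalIntegrable (fun t => ∑ i, x t i ^ 2) volume 0 T :=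
    (continuousOn_finsetSum _ fun i _ => (hxc i).pow 2).intervalIntegrable
  refine ⟨hx2, ?_⟩
  obtain ⟨hV, hVeq⟩ := hxu.integral_two_mul_dotProduct hsymm hT
  have hle := intervalIntegral.integral_mono hT hV ((hu2.const_mul (γ ^ 2)).sub hx2)
    fun t => hdiss (x t) (u t)
  rw [hVeq, intervalIntegral.integral_sub (hu2.const_mul _) hx2,
    intervalIntegral.integral_const_mul] at hle
  linarith [hnn (x T)]

/-- The storage (x - x*)ᵀM(x - x*) has derivative 2(x - x*)ᵀM in x, so its rate along `f` is the
left side of `hdiss`. -/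
theorem Sys.isXEID_of_quadratic [DecidableEq n] [DecidableEq q] (hM : M.PosDef)
    (hh : ∀ x u, S.h x u = x)
    (hdiss : ∀ x u xs us, S.f xs us = 0 →
      2 * ((x - xs) ⬝ᵥ M *ᵥ S.f x u) ≤ γ ^ 2 * ∑ i, (u - us) i ^ 2 - ∑ i, (x - xs) i ^ 2) :
    S.IsXEID (Matrix.fromBlocks (γ ^ 2 • 1) 0 0 (-1)) := by
  have hsymm : M.IsSymm := by simpa [Matrix.IsHermitian, Matrix.IsSymm] using hM.isHermitian
  have hexp : ∀ x : n → ℝ, x ⬝ᵥ M *ᵥ x = ∑ i, x i * ∑ j, M i j * x j := fun x => rfl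
  refine ⟨fun x xs => (x - xs) ⬝ᵥ M *ᵥ (x - xs), ?_, fun xs _ us hus => ⟨by simp, ?_, ?_⟩⟩
  · simp only [hexp, Pi.sub_apply]
    fun_prop
  · intro x hx
    simpa using hM.dotProduct_mulVec_pos (sub_ne_zero.2 hx)
  · intro x u
    have hd : HasFDerivAt (fun x' => (x' - xs) ⬝ᵥ M *ᵥ (x' - xs))
        (LinearMap.toContinuousLinearMap ((2 : ℝ) • Matrix.toBilin' M (x - xs))) x := by
      have h1 : ∀ i, HasFDerivAt (fun x' : n → ℝ => (x' - xs) i)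
          (ContinuousLinearMap.proj (R := ℝ) (φ := fun _ : n => ℝ) i) x := fun i => by
        simpa using (hasFDerivAt_apply i x).sub_const (xs i)
      have h2 := HasFDerivAt.fun_sum (u := Finset.univ) fun i _ => (h1 i).fun_mul
        (HasFDerivAt.fun_sum (u := Finset.univ) fun j _ => (h1 j).const_mul (M i j))
      refine h2.congr_fderiv ?_
      ext v
      have : ((2 : ℝ) • Matrix.toBilin' M (x - xs)) v = (x - xs) ⬝ᵥ M *ᵥ v + v ⬝ᵥ M *ᵥ (x - xs) := by
        rw [dotProduct_mulVec_comm_of_isSymm hsymm v, LinearMap.smul_apply,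
          Matrix.toBilin'_apply', smul_eq_mul]
        ring
      rw [LinearMap.coe_toContinuousLinearMap', this]
      simp [dotProduct, Matrix.mulVec, Finset.sum_add_distrib, Finset.mul_sum,
        mul_assoc, mul_comm, mul_left_comm]
    rw [hd.fderiv]
    have h := hdiss x u xs us hus
    rw [LinearMap.coe_toContinuousLinearMap', LinearMap.smul_apply, Matrix.toBilin'_apply',
      smul_eq_mul]
    refine h.trans_eq ?_
    beta_reduce
    rw [Matrix.fromBlocks_mulVec, Sum.elim_comp_inl, Sum.elim_comp_inr, hh, hh]
    generalize u - us = v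
    generalize x - xs = y
    simp only [sumElim_dotProduct_sumElim, Matrix.smul_mulVec, Matrix.neg_mulVec,
      Matrix.one_mulVec, Matrix.zero_mulVec, add_zero, zero_add, dotProduct_smul, dotProduct_neg,
      smul_eq_mul]
    simp only [dotProduct, pow_two, sub_eq_add_neg]

theorem Sys.finiteGainL2Stable_of_quadratic [DecidableEq n] [DecidableEq q] (hM : M.PosDef)
    (hh : ∀ x u, S.h x u = x) (h0 : S.f 0 0 = 0)
    (hdiss : ∀ x u xs us, S.f xs us = 0 →
      2 * ((x - xs) ⬝ᵥ M *ᵥ S.f x u) ≤ γ ^ 2 * ∑ i, (u - us) i ^ 2 - ∑ i, (x - xs) i ^ 2) :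
    S.FiniteGainL2Stable γ :=
  ⟨S.isXEID_of_quadratic hM hh hdiss,
    S.hasL2Gain_of_quadratic hM.posSemidef hh fun x u => by simpa using hdiss x u 0 0 h0⟩

end QuadraticStorage

/-! ### Controller gains encoded by the designed blocks -/

section GainsOfBlocks

theorem blk_inj {κ κ' : ℝ} {l l' : Fin 3 → ℝ} : blk κ l = blk κ' l' ↔ κ = κ' ∧ l = l' := by
  refine ⟨fun h => ⟨by simpa [blk] using congrFun₂ h 1 2, ?_⟩, by rintro ⟨rfl, rfl⟩; rfl⟩
  funext s
  have := congrFun₂ h 2 s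
  fin_cases s <;> simpa [blk] using this

theorem smul_blk (c κ : ℝ) (l : Fin 3 → ℝ) : c • blk κ l = blk (c * κ) (c • l) := by
  ext r s
  fin_cases r <;> fin_cases s <;> simp [blk]

theorem sum_blk {ι : Type*} (s : Finset ι) (κ : ι → ℝ) (l : ι → Fin 3 → ℝ) :
    ∑ i ∈ s, blk (κ i) (l i) = blk (∑ i ∈ s, κ i) (∑ i ∈ s, l i) := by
  ext r t
  rw [Matrix.sum_apply]
  fin_cases r <;> fin_cases t <;> simp [blk]

namespace Design

variable {D D' : Design} {φ : Formulation} {pbar : ℕ → ℝ} {γbar : ℝ} {n : ℕ}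

/-- Since Vᵢ is a multiple of the identity, passing from `Q` to `K` only rescales and keeps the
block structure. -/
theorem K_eq_smul {i : ℕ} (h : D.p i * (D.loc i).ν ≠ 0) (j : ℕ) :
    D.K i j = (-(D.p i * (D.loc i).ν))⁻¹ • D.Q i j := by
  have : (D.V i)⁻¹ = (-(D.p i * (D.loc i).ν))⁻¹ • (1 : Blk) := by
    refine Matrix.inv_eq_left_inv ?_
    rw [V, smul_mul_smul_comm, inv_mul_cancel₀ (neg_ne_zero.2 h), one_smul, one_mul]
  rw [K, this, smul_mul_assoc, one_mul]

/-- The coupling blocks have the structure that the formulation prescribes. -/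
theorem exists_K_eq_blk (hD : ∀ i < n, D.StepFeasible φ (pbar i) γbar i) :
    ∃ (κ : ℕ → ℕ → ℝ) (l : ℕ → ℕ → Fin 3 → ℝ), ∀ i < n, ∀ j < n, D.K i j = blk (κ i j) (l i j) ∧
      match (generalizing := false) φ with
      | .I => i ≠ j → l i j = 0
      | .II => κ i j = 0 := by
  have key : ∀ i j, ∃ (κ : ℝ) (l : Fin 3 → ℝ), i < n → j < n → D.K i j = blk κ l ∧
      match (generalizing := false) φ with
      | .I => i ≠ j → l = 0
      | .II => κ = 0 := by
    intro i j
    by_cases h : i < n ∧ j < n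
    · obtain ⟨hi, hj⟩ := h
      -- An off-diagonal block is chosen by the later of its two vehicles, whose step guarantees the
      -- structure.
      have hs : D.Structured φ i j := by
        rcases lt_trichotomy i j with h | rfl | h
        · exact ((hD j hj).structured i h).2
        · exact (hD i hi).structured_self
        · exact ((hD i hi).structured j h).1
      have hpν := mul_ne_zero (hD i hi).p_pos.ne' (hD i hi).localLMI.ν_neg.ne
      cases φ with
      | I =>
        by_cases hij : i = j
        · obtain ⟨κ, l, h⟩ : ∃ κ l, D.Q i j = blk κ l := by simpa [Structured, hij] using hs
          exact ⟨_, _, fun _ _ => ⟨by rw [K_eq_smul hpν, h, smul_blk], fun h => absurd hij h⟩⟩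
        · obtain ⟨κ, h⟩ : ∃ κ, D.Q i j = blk κ 0 := by simpa [Structured, hij] using hs
          exact ⟨_, _, fun _ _ => ⟨by rw [K_eq_smul hpν, h, smul_blk], fun _ => smul_zero _⟩⟩
      | II =>
        obtain ⟨l, h⟩ : ∃ l, D.Q i j = blk 0 l := hs
        exact ⟨_, _, fun _ _ => ⟨by rw [K_eq_smul hpν, h, smul_blk], mul_zero _⟩⟩
    · exact ⟨0, 0, fun hi hj => absurd ⟨hi, hj⟩ h⟩
  choose κ l h using key
  exact ⟨κ, l, fun i hi j hj => h i j hi hj⟩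

/-- Initialization supplies the row sum up to the diagonal and each later step adds one block; a
skipped update would have added zero. -/
theorem leaderBlk_eq_sum {j : ℕ} (hj : j < n) :
    D.leaderBlk n j = ∑ l ∈ Finset.range n, D.K j l := by
  induction n with
  | zero => exact absurd hj (Nat.not_lt_zero _)
  | succ n ih =>
    rw [leaderBlk, Finset.sum_range_succ]
    split_ifs with h1 h2
    · subst h1
      rw [add_comm]
    · rw [ih h2.1]
    · have hjn : j < n := by omega
      have : D.K j n = 0 := by
        by_contra h
        exact h2 ⟨hjn, h⟩
      rw [ih hjn, this, add_zero]

theorem leaderBlk_eq_sum_fin (i : Fin n) : D.leaderBlk n i = ∑ l : Fin n, D.K i l := by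
  rw [leaderBlk_eq_sum i.2, Finset.sum_range]

/-- The entries of `blk` can be read off: links fix the off-diagonal gains up to sign, and leader
blocks, being row sums of the same structure, fix the rest. -/
theorem existsUnique_realizes (hD : ∀ i < n, D.StepFeasible φ (pbar i) γbar i) :
    ∃! c : Gains φ n, D.Realizes φ n c := by
  obtain ⟨κ, l, hK⟩ := exists_K_eq_blk hD
  have hKb : ∀ i j : Fin n, D.K i j = blk (κ i j) (l i j) := fun i j => (hK i i.2 j j.2).1
  have hlead : ∀ i : Fin n, D.leaderBlk n i =
      blk (∑ j : Fin n, κ i j) (∑ j : Fin n, l i j) := fun i => by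
    rw [leaderBlk_eq_sum_fin, ← sum_blk]
    simp only [hKb]
  cases φ with
  | I =>
    let c : GainsI n :=
      { kbar := fun i j => if i = j then 0 else -κ i j
        kbar_self := fun i => if_pos rfl
        -- The `+ 1` cancels the `- 1` in the leader block of formulation I.
        kbar0 := fun i => ∑ j : Fin n, κ i j + 1
        L := fun i => ∑ j : Fin n, l i j }
    refine ⟨c, ⟨fun i j hij => ?_, fun i => ?_⟩, fun c' hc' => ?_⟩
    · rw [hKb, (hK i i.2 j j.2).2 (Fin.val_ne_of_ne hij)]
      simp [Gains.link, c, hij]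
    · rw [hlead]
      simp [Gains.leader, c]
    · refine GainsI.ext ?_ ?_ ?_
      · funext i j
        by_cases hij : i = j
        · subst hij
          rw [c.kbar_self]
          exact GainsI.kbar_self c' i
        · have := (blk_inj.1 ((hc'.link i j hij).trans (hKb i j))).1
          simp only [c, hij, if_false]
          exact neg_eq_iff_eq_neg.1 this
      · funext i
        exact sub_eq_iff_eq_add.1 (blk_inj.1 ((hc'.leader i).trans (hlead i))).1
      · funext i
        exact (blk_inj.1 ((hc'.leader i).trans (hlead i))).2
  | II =>
    let c : GainsII n :=
      { L := fun i j => if i = j then ∑ k : Fin n, l i k else -l i j }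
    have hκ : ∀ i j : Fin n, κ i j = 0 := fun i j => (hK i i.2 j j.2).2
    refine ⟨c, ⟨fun i j hij => ?_, fun i => ?_⟩, fun c' hc' => ?_⟩
    · rw [hKb, hκ]
      simp [Gains.link, c, hij]
    · rw [hlead]
      simp [Gains.leader, c, hκ]
    · refine GainsII.ext ?_
      funext i j
      by_cases hij : i = j
      · subst hij
        simp only [c, if_true]
        exact (blk_inj.1 ((hc'.leader i).trans (hlead i))).2
      · have := (blk_inj.1 ((hc'.link i j hij).trans (hKb i j))).2
        simp only [c, hij, if_false]
        exact neg_eq_iff_eq_neg.1 this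

/-- Gains produce the diagonal block Kᵢ₀ - Σ_{j≠i} Kᵢⱼ; as Kᵢ₀ is the full row sum, what remains is
Kᵢᵢ. -/
theorem Realizes.coupling_eq (hD : ∀ i < n, D.StepFeasible φ (pbar i) γbar i) {c : Gains φ n}
    (hc : D.Realizes φ n c) (i j : Fin n) : Gains.coupling φ c i j = D.K i j := by
  obtain ⟨κ, l, hK⟩ := exists_K_eq_blk hD
  have hKb : ∀ i j : Fin n, D.K i j = blk (κ i j) (l i j) := fun i j => (hK i i.2 j j.2).1
  have hlead : ∀ i : Fin n, D.leaderBlk n i =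
      blk (∑ j : Fin n, κ i j) (∑ j : Fin n, l i j) := fun i => by
    rw [leaderBlk_eq_sum_fin, ← sum_blk]
    simp only [hKb]
  rw [hKb]
  cases φ with
  | I =>
    have hlink := fun i j hij => blk_inj.1 ((hc.link i j hij).trans (hKb i j))
    have hleader := fun i => blk_inj.1 ((hc.leader i).trans (hlead i))
    refine blk_inj.2 ?_
    by_cases hij : i = j
    · subst hij
      have h0 := (hleader i).1
      have hsum : ∑ k, GainsI.kbar c i k = ∑ k ∈ Finset.univ.erase i, -κ i k := by
        rw [← Finset.add_sum_erase _ _ (Finset.mem_univ i), GainsI.kbar_self c i, zero_add]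
        exact Finset.sum_congr rfl fun k hk =>
          neg_eq_iff_eq_neg.1 (hlink i k (Finset.ne_of_mem_erase hk).symm).1
      rw [← Finset.add_sum_erase _ _ (Finset.mem_univ i)] at h0
      simp only [if_true, GainsI.k, hsum, Finset.sum_neg_distrib]
      refine ⟨by linarith, (hleader i).2.trans ?_⟩
      -- In formulation I the off-diagonal blocks have zero last row, so only the diagonal
      -- contributes.
      exact Finset.sum_eq_single i
        (fun k _ hk => (hK i i.2 k k.2).2 (Fin.val_ne_of_ne hk.symm)) (by simp)
    · simp only [hij, if_false, GainsI.k, sub_zero]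
      exact ⟨(hlink i j hij).1, (hlink i j hij).2⟩
  | II =>
    have hlink := fun i j hij => blk_inj.1 ((hc.link i j hij).trans (hKb i j))
    have hleader := fun i => blk_inj.1 ((hc.leader i).trans (hlead i))
    refine blk_inj.2 ⟨((hK i i.2 j j.2).2).symm, ?_⟩
    by_cases hij : i = j
    · subst hij
      have hsum : ∑ k ∈ Finset.univ.erase i, GainsII.L c i k =
          ∑ k ∈ Finset.univ.erase i, -l i k := Finset.sum_congr rfl fun k hk =>
        neg_eq_iff_eq_neg.1 (hlink i k (Finset.ne_of_mem_erase hk).symm).2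
      simp only [GainsII.Kbar, if_true, hsum, (hleader i).2, Finset.sum_neg_distrib]
      rw [← Finset.add_sum_erase _ _ (Finset.mem_univ i), add_neg_cancel_right]
    · simp only [GainsII.Kbar, hij, if_false]
      exact (hlink i j hij).2

/-! ### Compositionality -/

namespace AgreeOn

theorem symm (h : D.AgreeOn D' n) : D'.AgreeOn D n :=
  ⟨fun i hi => (h.loc i hi).symm, fun i hi j hj => (h.Q i hi j hj).symm,
    fun i hi => (h.p i hi).symm, fun i hi => (h.γhat i hi).symm⟩

theorem K_eq (h : D.AgreeOn D' n) {i j : ℕ} (hi : i < n) (hj : j < n) : D.K i j = D'.K i j := by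
  rw [K, K, V, V, h.loc i hi, h.p i hi, h.Q i hi j hj]

theorem W_eq (h : D.AgreeOn D' n) {i j : ℕ} (hi : i < n) (hj : j < n) : D.W i j = D'.W i j := by
  simp only [W, Wblocks, V, R, S, h.loc i hi, h.loc j hj, h.p i hi, h.Q i hi j hj, h.Q j hj i hi,
    h.γhat i hi]

theorem structured_iff (h : D.AgreeOn D' n) {i j : ℕ} (hi : i < n) (hj : j < n) :
    D.Structured φ i j ↔ D'.Structured φ i j := by
  simp only [Structured, h.Q i hi j hj]

theorem stepFeasible (h : D.AgreeOn D' n) {p : ℝ} {i : ℕ} (hi : i < n)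
    (hD : D.StepFeasible φ p γbar i) : D'.StepFeasible φ p γbar i where
  localLMI := h.loc i hi ▸ hD.localLMI
  structured_self := (h.structured_iff hi hi).1 hD.structured_self
  structured j hj := ⟨(h.structured_iff hi (hj.trans hi)).1 (hD.structured j hj).1,
    (h.structured_iff (hj.trans hi) hi).1 (hD.structured j hj).2⟩
  p_pos := h.p i hi ▸ hD.p_pos
  γhat_lt := h.γhat i hi ▸ hD.γhat_lt
  tilde_pos := tilde_congr (fun _ hi _ hj => h.W_eq hi hj) i hi ▸ hD.tilde_pos

theorem realizes (h : D.AgreeOn D' n) {c : Gains φ n} (hc : D.Realizes φ n c) :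
    D'.Realizes φ n c where
  link i j hij := (hc.link i j hij).trans (h.K_eq i.2 j.2)
  leader i := by
    rw [hc.leader i, leaderBlk_eq_sum_fin, leaderBlk_eq_sum_fin]
    exact Finset.sum_congr rfl fun l _ => h.K_eq i.2 l.2

end AgreeOn

end Design

end GainsOfBlocks

/-! ### Local dissipation, interconnection and the closed loop -/

section Dissipation

open Matrix

theorem dotProduct_comp_mulVec {I J R : Type*} [Fintype I] [Fintype J] [CommRing R]
    (M : Matrix I I (Matrix J J R)) (x y : I × J → R) :
    x ⬝ᵥ Matrix.comp _ _ _ _ R M *ᵥ y =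
      ∑ i, ∑ j, (fun s => x (i, s)) ⬝ᵥ M i j *ᵥ fun s => y (j, s) := by
  simp only [dotProduct, Matrix.mulVec, Fintype.sum_prod_type, Matrix.comp_apply, Finset.mul_sum]
  exact Finset.sum_congr rfl fun i _ => Finset.sum_comm

theorem dotProduct_comp_diagonal_mulVec {I J R : Type*} [Fintype I] [DecidableEq I] [Fintype J]
    [CommRing R] (d : I → Matrix J J R) (x y : I × J → R) :
    x ⬝ᵥ Matrix.comp _ _ _ _ R (Matrix.diagonal d) *ᵥ y =
      ∑ i, (fun s => x (i, s)) ⬝ᵥ d i *ᵥ fun s => y (i, s) := by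
  rw [dotProduct_comp_mulVec]
  refine Finset.sum_congr rfl fun i _ => ?_
  rw [Finset.sum_eq_single i]
  · rw [Matrix.diagonal_apply_eq]
  · intro j _ hj
    rw [Matrix.diagonal_apply_ne _ hj.symm, Matrix.zero_mulVec, dotProduct_zero]
  · simp

theorem posDef_comp_diagonal {I J : Type*} [Fintype I] [DecidableEq I] [Fintype J]
    {d : I → Matrix J J ℝ} (hd : ∀ i, (d i).PosDef) :
    (Matrix.comp _ _ _ _ ℝ (Matrix.diagonal d)).PosDef := by
  refine Matrix.PosDef.of_dotProduct_mulVec_pos ?_ fun {x} hx => ?_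
  · ext ⟨i, r⟩ ⟨j, s⟩
    by_cases h : i = j
    · subst h
      simpa using (hd i).isHermitian.apply r s
    · simp [Matrix.diagonal_apply_ne _ h, Matrix.diagonal_apply_ne' _ h]
  · rw [star_trivial, dotProduct_comp_diagonal_mulVec]
    obtain ⟨⟨i, s⟩, his⟩ := Function.ne_iff.1 hx
    refine Finset.sum_pos' (fun j _ => ?_) ⟨i, Finset.mem_univ i, ?_⟩
    · simpa using (hd j).posSemidef.dotProduct_mulVec_nonneg fun s => x (j, s)
    · simpa using (hd i).dotProduct_mulVec_pos (x := fun s => x (i, s))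
        fun h => his (congrFun h s)

/-- The local LMI makes a vehicle strictly passive with indices `ν` and `ρ`. -/
theorem LocalVars.Feasible.dissipation {d : LocalVars} {p : ℝ} (h : d.Feasible p)
    (x η : Fin 3 → ℝ) :
    2 * (x ⬝ᵥ d.P⁻¹ *ᵥ ((A + B * d.Lbar) *ᵥ x + η)) ≤
      -d.ν * (η ⬝ᵥ η) + η ⬝ᵥ x - d.ρ * (x ⬝ᵥ x) := by
  have hPs : d.P.IsSymm := by
    simpa [Matrix.IsHermitian, Matrix.IsSymm] using h.P_pos.isHermitian
  have hdet : IsUnit d.P.det := (Matrix.isUnit_iff_isUnit_det _).1 h.P_pos.isUnit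
  set y := d.P⁻¹ *ᵥ x with hy
  have hPy : d.P *ᵥ y = x := by
    rw [hy, Matrix.mulVec_mulVec, Matrix.mul_nonsing_inv _ hdet, Matrix.one_mulVec]
  have hyP : ∀ z, y ⬝ᵥ d.P *ᵥ z = z ⬝ᵥ x := fun z => by
    rw [dotProduct_mulVec_comm_of_isSymm hPs, hPy]
  have hAx : (A + B * d.Lbar) *ᵥ x = (A * d.P + B * d.Ltil) *ᵥ y := by
    rw [hy, Matrix.mulVec_mulVec, Matrix.add_mul, Matrix.mul_assoc A,
      Matrix.mul_nonsing_inv _ hdet, Matrix.mul_one, LocalVars.Lbar, Matrix.mul_assoc]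
  have hxP : ∀ z, x ⬝ᵥ d.P⁻¹ *ᵥ z = y ⬝ᵥ z := fun z => by
    have hPis : d.P⁻¹.IsSymm := by rw [Matrix.IsSymm, Matrix.transpose_nonsing_inv, hPs.eq]
    rw [dotProduct_mulVec_comm_of_isSymm hPis, dotProduct_comm]
  set H := A * d.P + B * d.Ltil with hH
  have hHt : y ⬝ᵥ Hᵀ *ᵥ y = y ⬝ᵥ H *ᵥ y := by
    rw [Matrix.mulVec_transpose, dotProduct_comm, ← Matrix.dotProduct_mulVec]
  have hρ : d.ρtil * d.ρ = 1 := by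
    rw [LocalVars.ρ, mul_one_div_cancel h.ρtil_pos.ne']
  -- With y = P⁻¹x, the first component -ρx minimizes ρ̃|a|² + 2a·Py over a; this Schur complement
  -- choice leaves exactly -ρ|x|².
  have key := h.lmi_pos.posSemidef.dotProduct_mulVec_nonneg
    (fun a : Fin 3 × Fin 3 => (![-d.ρ • x, y, η] : Fin 3 → Fin 3 → ℝ) a.1 a.2)
  rw [star_trivial, dotProduct_comp_mulVec] at key
  simp only [Fin.sum_univ_three, LocalVars.lmiBlocks, ← hH, Matrix.of_apply, Matrix.cons_val_zero,
    Matrix.cons_val_one, Matrix.cons_val, Matrix.smul_mulVec, Matrix.one_mulVec,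
    Matrix.zero_mulVec, Matrix.neg_mulVec, Matrix.add_mulVec, dotProduct_add, dotProduct_neg,
    dotProduct_smul, smul_dotProduct, Matrix.mulVec_smul, hPy, hyP, hHt, dotProduct_zero,
    smul_eq_mul, neg_smul, neg_dotProduct, Matrix.mulVec_neg] at key
  rw [hxP, hAx, dotProduct_add]
  have e1 := dotProduct_comm y η
  have e2 := dotProduct_comm x η
  have e3 : d.ρtil * (d.ρ * (d.ρ * (x ⬝ᵥ x))) = d.ρ * (x ⬝ᵥ x) := by
    rw [← mul_assoc, hρ, one_mul]
  linarith

namespace Design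

variable {D : Design} {φ : Formulation} {pbar : ℕ → ℝ} {γbar : ℝ} {n : ℕ}

/-- The corner blocks match because Vᵢ and Sᵢ are multiples of the identity and commute. -/
theorem transpose_W (i j : ℕ) : (D.W i j)ᵀ = D.W j i := by
  have h : ∀ a b, (D.Wblocks i j a b)ᵀ = D.Wblocks j i b a := by
    intro a b
    by_cases hij : i = j
    · subst hij
      fin_cases a <;> fin_cases b <;>
        simp [Wblocks, V, S, R, sub_eq_add_neg, add_comm, smul_comm (D.p i * (D.loc i).ν)]
    · fin_cases a <;> fin_cases b <;>
        simp [Wblocks, V, S, R, hij, Ne.symm hij, sub_eq_add_neg, add_comm]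
  ext ⟨a, r⟩ ⟨b, s⟩
  exact congrFun₂ (h b a) r s

/-- The quadratic form of `Wᵢⱼ` at the vectors `(-ηᵢ, -xᵢ, xᵢ, wᵢ)`. -/
theorem dotProduct_W_mulVec (η x w : ℕ → Fin 3 → ℝ) (i j : ℕ) :
    (fun a : Fin 4 × Fin 3 => (![-η i, -x i, x i, w i] : Fin 4 → Fin 3 → ℝ) a.1 a.2) ⬝ᵥ
      D.W i j *ᵥ (fun a : Fin 4 × Fin 3 => (![-η j, -x j, x j, w j] : Fin 4 → Fin 3 → ℝ) a.1 a.2) =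
    -((η i - (1 / (2 * (D.loc i).ν)) • x i) ⬝ᵥ D.Q i j *ᵥ x j) +
      -((η j - (1 / (2 * (D.loc j).ν)) • x j) ⬝ᵥ D.Q j i *ᵥ x i) +
      if i = j then
        -(D.p i * (D.loc i).ν) * (η i ⬝ᵥ η i - 2 * (η i ⬝ᵥ w i)) - x i ⬝ᵥ x i +
          D.p i * (D.loc i).ρ * (x i ⬝ᵥ x i) -
          2 * (1 / (2 * (D.loc i).ν) * (D.p i * (D.loc i).ν)) * (x i ⬝ᵥ w i) +
          D.γhat i * (w i ⬝ᵥ w i)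
      else 0 := by
  rw [W, dotProduct_comp_mulVec]
  change ∑ a, ∑ b, (![-η i, -x i, x i, w i] : Fin 4 → Fin 3 → ℝ) a ⬝ᵥ
    D.Wblocks i j a b *ᵥ (![-η j, -x j, x j, w j] : Fin 4 → Fin 3 → ℝ) b = _
  have ht : ∀ u v : Fin 3 → ℝ, u ⬝ᵥ (D.Q j i)ᵀ *ᵥ v = v ⬝ᵥ D.Q j i *ᵥ u := fun u v => by
    rw [Matrix.mulVec_transpose, dotProduct_comm, ← Matrix.dotProduct_mulVec]
  by_cases hij : i = j
  · subst hij
    simp [Fin.sum_univ_four, Wblocks, V, S, R, Matrix.smul_mulVec, Matrix.neg_mulVec,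
      Matrix.add_mulVec, Matrix.mulVec_neg, ht]
    have e1 := dotProduct_comm (w i) (η i)
    have e2 := dotProduct_comm (w i) (x i)
    rw [e1, e2]
    ring
  · simp [Fin.sum_univ_four, Wblocks, V, S, R, hij, Matrix.smul_mulVec, Matrix.add_mulVec,
      Matrix.mulVec_neg, ht]
    ring

/-- The interconnection LMIs bound the total supply to the vehicles. -/
theorem sum_supply_le (hD : ∀ i < n, D.StepFeasible φ (pbar i) γbar i)
    (η x w : ℕ → Fin 3 → ℝ) (hη : ∀ i < n, η i = ∑ j : Fin n, D.K i j *ᵥ x j + w i) :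
    ∑ i : Fin n, D.p i * (-(D.loc i).ν * (η i ⬝ᵥ η i) + η i ⬝ᵥ x i - (D.loc i).ρ * (x i ⬝ᵥ x i)) ≤
      ∑ i : Fin n, (D.γhat i * (w i ⬝ᵥ w i) - x i ⬝ᵥ x i) := by
  have key := sum_dotProduct_nonneg_of_tilde_posDef (W := D.W) transpose_W
    (fun k hk => (hD k hk).tilde_pos)
    (fun i : Fin n => fun a : Fin 4 × Fin 3 =>
      (![-η i, -x i, x i, w i] : Fin 4 → Fin 3 → ℝ) a.1 a.2)
  simp only [dotProduct_W_mulVec, Finset.sum_add_distrib] at key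
  -- Exchanging i and j makes the contribution of the transposed `Q` blocks equal to that of the `Q`
  -- blocks.
  rw [Finset.sum_comm (f := fun i j : Fin n =>
    -((η j - (1 / (2 * (D.loc j).ν)) • x j) ⬝ᵥ D.Q j i *ᵥ x i))] at key
  simp only [← Finset.sum_add_distrib, Fin.val_inj, Finset.sum_ite_eq, Finset.mem_univ,
    if_true] at key
  rw [← sub_nonneg, ← Finset.sum_sub_distrib]
  refine key.trans_eq (Finset.sum_congr rfl fun i _ => ?_)
  have hp := (hD i i.2).p_pos
  have hν := (hD i i.2).localLMI.ν_neg
  -- This is Vᵢ(ηᵢ - wᵢ). Once it is substituted, the products of wᵢ with ηᵢ and xᵢ cancel against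
  -- the diagonal terms.
  have hQ : ∑ j : Fin n, D.Q i j *ᵥ x j = -(D.p i * (D.loc i).ν) • (η i - w i) := by
    rw [hη i i.2, add_sub_cancel_right, Finset.smul_sum]
    refine Finset.sum_congr rfl fun j _ => ?_
    have hne := mul_ne_zero hp.ne' hν.ne
    rw [K_eq_smul hne, Matrix.smul_mulVec, smul_smul, mul_inv_cancel₀ (neg_ne_zero.2 hne),
      one_smul]
  rw [Finset.sum_add_distrib, Finset.sum_neg_distrib, ← dotProduct_sum, hQ]
  simp only [sub_dotProduct, dotProduct_sub, dotProduct_smul, smul_dotProduct, smul_eq_mul]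
  rw [dotProduct_comm (x i) (η i)]
  field_simp [hν.ne]
  ring

theorem closedLoop_dissipation (hD : ∀ i < n, D.StepFeasible φ (pbar i) γbar i) {c : Gains φ n}
    (hc : D.Realizes φ n c) {γ : ℝ} (hγ : ∀ i < n, D.γhat i ≤ γ ^ 2)
    (x w : Fin n × Fin 3 → ℝ) :
    2 * (x ⬝ᵥ Matrix.comp _ _ _ _ ℝ
        (Matrix.diagonal fun i : Fin n => D.p i • (D.loc i).P⁻¹) *ᵥ (D.closedLoop φ n c).f x w) ≤
      γ ^ 2 * ∑ a, w a ^ 2 - ∑ a, x a ^ 2 := by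
  -- Designs are indexed by `ℕ`, so signals are extended by zero beyond vehicle n - 1.
  let ext (v : Fin n × Fin 3 → ℝ) : ℕ → Fin 3 → ℝ := fun i =>
    if h : i < n then fun s => v (⟨i, h⟩, s) else 0
  have hext : ∀ v (i : Fin n), ext v i = fun s => v (i, s) := fun v i => by simp [ext]
  let η : ℕ → Fin 3 → ℝ := fun i => ∑ j : Fin n, D.K i j *ᵥ ext x j + ext w i
  have hf : ∀ i : Fin n, (fun s => (D.closedLoop φ n c).f x w (i, s)) =
      (A + B * (D.loc i).Lbar) *ᵥ ext x i + η i := by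
    intro i
    funext s
    simp [closedLoop, errorDynamics, hc.coupling_eq hD, η, hext]
  rw [dotProduct_comp_diagonal_mulVec, Finset.mul_sum]
  have h1 : ∀ i : Fin n, 2 * ((fun s => x (i, s)) ⬝ᵥ (D.p i • (D.loc i).P⁻¹) *ᵥ
      fun s => (D.closedLoop φ n c).f x w (i, s)) ≤ D.p i * (-(D.loc i).ν * (η i ⬝ᵥ η i) +
        η i ⬝ᵥ ext x i - (D.loc i).ρ * (ext x i ⬝ᵥ ext x i)) := by
    intro i
    rw [hf, ← hext, Matrix.smul_mulVec, dotProduct_smul, smul_eq_mul, mul_left_comm]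
    exact mul_le_mul_of_nonneg_left ((hD i i.2).localLMI.dissipation _ _) (hD i i.2).p_pos.le
  refine (Finset.sum_le_sum fun i _ => h1 i).trans
    ((sum_supply_le hD η (ext x) (ext w) fun i _ => rfl).trans ?_)
  rw [Fintype.sum_prod_type, Fintype.sum_prod_type, Finset.mul_sum, ← Finset.sum_sub_distrib]
  refine Finset.sum_le_sum fun i _ => ?_
  have hsq : ∀ v : Fin n × Fin 3 → ℝ, ext v i ⬝ᵥ ext v i = ∑ s, v (i, s) ^ 2 := fun v => by
    simp only [hext, dotProduct, pow_two]
  rw [hsq, hsq]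
  exact sub_le_sub_right (mul_le_mul_of_nonneg_right (hγ i i.2)
    (Finset.sum_nonneg fun s _ => sq_nonneg _)) _

/-- Linearity reduces dissipativity about any equilibrium to dissipativity about the origin. -/
theorem closedLoop_f_sub (c : Gains φ n) (x w xs ws : Fin n × Fin 3 → ℝ) :
    (D.closedLoop φ n c).f (x - xs) (w - ws) =
      (D.closedLoop φ n c).f x w - (D.closedLoop φ n c).f xs ws := by
  have h : ∀ j : Fin n, (fun s => (x - xs) (j, s)) = (fun s => x (j, s)) - fun s => xs (j, s) :=
    fun _ => rfl
  funext a
  simp only [closedLoop, errorDynamics, h, Matrix.mulVec_sub]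
  simp only [Pi.sub_apply, Finset.sum_sub_distrib]
  ring

theorem finiteGainL2Stable_closedLoop (hD : ∀ i < n, D.StepFeasible φ (pbar i) γbar i)
    {c : Gains φ n} (hc : D.Realizes φ n c) {γ : ℝ} (hγ : ∀ i < n, D.γhat i ≤ γ ^ 2) :
    (D.closedLoop φ n c).FiniteGainL2Stable γ := by
  refine Sys.finiteGainL2Stable_of_quadratic
    (M := Matrix.comp _ _ _ _ ℝ (Matrix.diagonal fun i : Fin n => D.p i • (D.loc i).P⁻¹))
    (posDef_comp_diagonal fun i => (hD i i.2).localLMI.P_pos.inv.smul (hD i i.2).p_pos)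
    (fun _ _ => rfl) ?_ fun x w xs ws h => ?_
  · simpa using closedLoop_f_sub (D := D) c 0 0 0 0
  · have := closedLoop_dissipation hD hc hγ (x - xs) (w - ws)
    rwa [closedLoop_f_sub, h, sub_zero] at this

/-- A positive gain `γ` with `γ² < γ̄` that dominates all the designed `γ̂ᵢ`. -/
theorem exists_gain (hγbar : 0 < γbar) (hD : ∀ i < n, D.StepFeasible φ (pbar i) γbar i) :
    ∃ γ : ℝ, 0 < γ ∧ γ ^ 2 < γbar ∧ ∀ i < n, D.γhat i ≤ γ ^ 2 := by
  -- Inserting γ̄/2 keeps the set nonempty when n = 0 and its maximum positive, while staying below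
  -- γ̄.
  obtain ⟨g, hg⟩ : ∃ g, g = insert (γbar / 2) ((Finset.range n).image D.γhat) := ⟨_, rfl⟩
  have hne : g.Nonempty := hg ▸ Finset.insert_nonempty _ _
  have hpos : 0 < g.max' hne :=
    (half_pos hγbar).trans_le (g.le_max' _ (by simp [hg]))
  refine ⟨√(g.max' hne), Real.sqrt_pos.2 hpos, ?_, fun i hi => ?_⟩
  · rw [Real.sq_sqrt hpos.le, Finset.max'_lt_iff]
    intro b hb
    simp only [hg, Finset.mem_insert, Finset.mem_image, Finset.mem_range] at hb
    rcases hb with rfl | ⟨i, hi, rfl⟩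
    · exact half_lt_self hγbar
    · exact (hD i hi).γhat_lt
  · rw [Real.sq_sqrt hpos.le]
    refine g.le_max' _ ?_
    rw [hg]
    exact Finset.mem_insert_of_mem (Finset.mem_image_of_mem _ (Finset.mem_range.2 hi))

end Design

end Dissipation

end Platoon

theorem theorem3 (φ : Platoon.Formulation) (N : ℕ) (γbar : ℝ) (hγbar : 0 < γbar)
    (pbar : ℕ → ℝ) (hpbar : ∀ i < N, 0 < pbar i)
    (D : Platoon.Design) (hD : ∀ i < N, D.StepFeasible φ (pbar i) γbar i) :
    -- after each of the `N` design steps, the platoon designed so far is `L₂`-stable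
    (∀ n ≤ N,
      (∃! c : Platoon.Gains φ n, D.Realizes φ n c) ∧
      ∀ c : Platoon.Gains φ n, D.Realizes φ n c →
        (∀ i j : Fin n, Platoon.Gains.coupling φ c i j = D.K i j) ∧
        ∃ γ : ℝ, 0 < γ ∧ γ ^ 2 < γbar ∧ (D.closedLoop φ n c).FiniteGainL2Stable γ) ∧
    -- the design of the first `n` vehicles does not depend on the choices of later vehicles
    (∀ (D' : Platoon.Design) (n : ℕ), D.AgreeOn D' n →
      (∀ i < n, D.StepFeasible φ (pbar i) γbar i ↔ D'.StepFeasible φ (pbar i) γbar i) ∧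
      ∀ c : Platoon.Gains φ n, D.Realizes φ n c ↔ D'.Realizes φ n c) := by
  refine ⟨fun n hn => ?_, fun D' n h => ⟨fun i hi => ⟨h.stepFeasible hi, h.symm.stepFeasible hi⟩,
    fun c => ⟨h.realizes, h.symm.realizes⟩⟩⟩
  have hDn : ∀ i < n, D.StepFeasible φ (pbar i) γbar i := fun i hi => hD i (hi.trans_le hn)
  refine ⟨Platoon.Design.existsUnique_realizes hDn, fun c hc => ⟨hc.coupling_eq hDn, ?_⟩⟩
  obtain ⟨γ, hγ, hγlt, hle⟩ := Platoon.Design.exists_gain hγbar hDn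
  exact ⟨γ, hγ, hγlt, Platoon.Design.finiteGainL2Stable_closedLoop hDn hc hle⟩
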